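/- An ordering of a finite simple graph $G$ is a pair $\mathcal{G}=(G,\prec)$, where $\prec$ is a total order on the vertex set of $G$. The ordered Ramsey number $\overline{R}(\mathcal{G})$ is the minimum integer $N$ such that every coloring of the edges of the complete graph on $\{1,\dots,N\}$ with two colors contains a monochromatic copy of $\mathcal{G}$, that is, there are a strictly increasing map $f$ from $(V(G),\prec)$ to $\{1,\dots,N\}$ and a color such that $\{f(u),f(v)\}$ has this color for every edge $\{u,v\}$ of $G$. Let $$\operatorname{min-}\overline{R}(G)=\min\{\overline{R}(\mathcal{G}) : \mathcal{G}\text{ is an ordering of }G\}.$$ **Theorem.** There is an absolute constant $C$ such that every graph $G$ on $n$ vertices with maximum degree at most $2$ satisfies $\operatorname{min-}\overline{R}(G)\le Cn$. -/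

import Mathlib

namespace OrderedRamsey

/-- The ordered graph `(G, <)`, where `<` is the given linear order on the vertex set of `G`, has an
isomorphic copy as an ordered subgraph of the ordered graph `(H, <)`: there is a strictly increasing
map of vertices which sends edges of `G` to edges of `H`. -/
def IsOrderedSubgraph {V W : Type*} [LinearOrder V] [LinearOrder W]
    (G : SimpleGraph V) (H : SimpleGraph W) : Prop :=
  ∃ f : V ↪o W, ∀ u v : V, G.Adj u v → H.Adj (f u) (f v)

/-- Every coloring with two colors of the edges of the ordered complete graph with `N` vertices
contains a monochromatic copy of the ordered graph `(G, <)`. -/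
def Arrows {V : Type*} [LinearOrder V] (N : ℕ) (G : SimpleGraph V) : Prop :=
  ∀ c : SimpleGraph.TopEdgeLabeling (Fin N) Bool,
    ∃ color : Bool, IsOrderedSubgraph G (c.labelGraph color)

/-- The ordered Ramsey number of the ordered graph `(G, <)`: the minimum `N` such that every
two-coloring of the ordered complete graph with `N` vertices contains a monochromatic copy of
`(G, <)`. It takes the value `⊤` if there is no such `N`, so that an upper bound on it by a natural
number includes the existence of such an `N`. -/
noncomputable def orderedRamseyNumber {V : Type*} [LinearOrder V] (G : SimpleGraph V) : ℕ∞ :=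
  ⨅ (N : ℕ) (_ : Arrows N G), (N : ℕ∞)

/-- The minimum of the ordered Ramsey numbers over all orderings of `G`, that is, over all linear
orders on the vertex set of `G`. -/
noncomputable def minOrderedRamseyNumber {V : Type*} (G : SimpleGraph V) : ℕ∞ :=
  ⨅ ord : LinearOrder V, @orderedRamseyNumber V ord G

end OrderedRamsey

namespace OrderedRamsey

open Finset

/-! Maximum degree two forces bandwidth at most two (`exists_bandwidth_le_two`), so `G` embeds in
the square of a path. The chosen ordering sorts path positions by residue mod 3, then by size. Cut
`6 * L` vertices into six intervals of length `L`. A point of the grid `[L]^6` selects one vertex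
from each, and three of these span a monochromatic triangle. By pigeonhole, one triple of intervals
and one color serve more than `n * L ^ 5` points. So dense a set contains a walk raising the three
coordinates cyclically (`exists_increasing_walk`). Successive triangles share an edge, so together
they trace a monochromatic square of a path in the chosen order, with `L` linear in `n`. -/

/-- The Ramsey number of the triangle is at most six. -/
lemma exists_monochromatic_triple (b : Fin 6 → Fin 6 → Bool) :
    ∃ (g : Fin 3 → Fin 6) (k : Bool), StrictMono g ∧ ∀ i j, i < j → b (g i) (g j) = k := by
  have key : ∃ (x y z : Fin 6) (k : Bool), x < y ∧ y < z ∧ b x y = k ∧ b x z = k ∧ b y z = k := by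
    by_contra hc
    push Not at hc
    have h (x y z : Fin 6) (hxy : x < y) (hyz : y < z) : ¬ (b x y = b x z ∧ b x z = b y z) :=
      fun h => hc x y z (b x y) hxy hyz rfl h.1.symm (h.1.trans h.2).symm
    have h' (y z w : Fin 6) (h0 : 0 < y) (hyz : y < z) (hzw : z < w) :
        ¬ (b 0 y = b 0 z ∧ b 0 z = b 0 w) := by
      have h1 := h 0 y z h0 hyz
      have h2 := h 0 z w (h0.trans hyz) hzw
      have h3 := h 0 y w h0 (hyz.trans hzw)
      have h4 := h y z w hyz hzw
      clear h hc
      generalize b 0 y = p at *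
      generalize b 0 z = q at *
      generalize b 0 w = r at *
      generalize b y z = s at *
      generalize b y w = t at *
      generalize b z w = u at *
      revert p q r s t u
      decide
    have h1 := h' 1 2 3 (by decide) (by decide) (by decide)
    have h2 := h' 1 2 4 (by decide) (by decide) (by decide)
    have h3 := h' 1 2 5 (by decide) (by decide) (by decide)
    have h4 := h' 1 3 4 (by decide) (by decide) (by decide)
    have h5 := h' 1 3 5 (by decide) (by decide) (by decide)
    have h6 := h' 1 4 5 (by decide) (by decide) (by decide)
    have h7 := h' 2 3 4 (by decide) (by decide) (by decide)
    have h8 := h' 2 3 5 (by decide) (by decide) (by decide)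
    have h9 := h' 2 4 5 (by decide) (by decide) (by decide)
    have h10 := h' 3 4 5 (by decide) (by decide) (by decide)
    clear h h' hc
    generalize b 0 1 = p at *
    generalize b 0 2 = q at *
    generalize b 0 3 = r at *
    generalize b 0 4 = s at *
    generalize b 0 5 = t at *
    cases p <;> cases q <;> cases r <;> cases s <;> cases t <;> simp_all
  obtain ⟨x, y, z, k, hxy, hyz, h1, h2, h3⟩ := key
  refine ⟨![x, y, z], k, ?_, ?_⟩
  · refine Fin.strictMono_iff_lt_succ.2 fun i => ?_
    fin_cases i
    · exact hxy
    · exact hyz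
  · intro i j hij
    fin_cases i <;> fin_cases j <;> first | exact absurd hij (by decide) | assumption

/-! ### Walks in dense subsets of a grid -/

section Walk

variable {ι : Type*} [Fintype ι] [DecidableEq ι] {L : ℕ}

/-- The points of `E` which can be increased within `E` by changing only the coordinate `a`. -/
def raisable (E : Finset (ι → Fin L)) (a : ι) : Finset (ι → Fin L) :=
  E.filter fun x => ∃ y ∈ E, x a < y a ∧ ∀ b, b ≠ a → y b = x b

/-- Each line in direction `a` has at most one non-raisable point of `E`, its top one, so forgetting
coordinate `a` is injective on these points. -/
lemma card_le_card_raisable_add (E : Finset (ι → Fin L)) (a : ι) :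
    #E ≤ #(raisable E a) + L ^ (Fintype.card ι - 1) := by
  have hsub : raisable E a ⊆ E := filter_subset _ _
  have hinj : #(E \ raisable E a) ≤ #(univ : Finset ({b : ι // b ≠ a} → Fin L)) := by
    refine card_le_card_of_injOn (fun x b => x b.1) (fun _ _ => mem_coe.2 (mem_univ _)) ?_
    intro x hx y hy hxy
    have hxy' : ∀ b, b ≠ a → x b = y b := fun b hb => congrFun hxy ⟨b, hb⟩
    simp only [raisable, coe_sdiff, Set.mem_sdiff, mem_coe, mem_filter, not_and, not_exists] at hx hy
    have h1 : ¬ x a < y a := fun h => hx.2 hx.1 y hy.1 h fun b hb => (hxy' b hb).symm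
    have h2 : ¬ y a < x a := fun h => hy.2 hy.1 x hx.1 h hxy'
    funext b
    by_cases hb : b = a
    · subst hb
      exact le_antisymm (not_lt.1 h2) (not_lt.1 h1)
    · exact hxy' b hb
  have hcard : #(univ : Finset ({b : ι // b ≠ a} → Fin L)) = L ^ (Fintype.card ι - 1) := by
    simp [Fintype.card_subtype_compl]
  have := card_sdiff_add_card_eq_card hsub
  omega

/-- A dense subset of a grid contains a long walk which increases a prescribed coordinate in each
step. -/
lemma exists_increasing_walk (d : ℕ → ι) (M : ℕ) (E : Finset (ι → Fin L))
    (hE : M * L ^ (Fintype.card ι - 1) < #E) :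
    ∃ x : ℕ → ι → Fin L, (∀ j ≤ M, x j ∈ E) ∧
      ∀ j < M, x j (d j) < x (j + 1) (d j) ∧ ∀ a, a ≠ d j → x (j + 1) a = x j a := by
  induction M generalizing E with
  | zero =>
    obtain ⟨x, hx⟩ := card_pos.1 (by omega : 0 < #E)
    exact ⟨fun _ => x, fun _ _ => hx, fun j hj => absurd hj (Nat.not_lt_zero j)⟩
  | succ M ih =>
    have h1 := card_le_card_raisable_add E (d M)
    -- The walk is built inside the raisable points, so its endpoint admits one more step, in
    -- direction `d M`.
    obtain ⟨x, hx, hstep⟩ := ih (raisable E (d M)) (by rw [add_mul] at hE; omega)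
    obtain ⟨hxM, y, hy, hlt, heq⟩ := mem_filter.1 (hx M le_rfl)
    refine ⟨fun j => if j ≤ M then x j else y, fun j _ => ?_, fun j hj => ?_⟩
    · dsimp only
      split_ifs with h
      · exact (mem_filter.1 (hx j h)).1
      · exact hy
    · rcases Nat.lt_succ_iff_lt_or_eq.1 hj with h | rfl
      · simpa [h.le, Nat.succ_le_of_lt h] using hstep j h
      · simpa using ⟨hlt, heq⟩

end Walk

/-! ### Bandwidth of graphs of maximum degree two -/

/-- A graph with maximum degree at most two has bandwidth at most two. -/
lemma exists_bandwidth_le_two {V : Type*} [Fintype V] (G : SimpleGraph V)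
    (hG : ∀ v w₁ w₂ w₃, G.Adj v w₁ → G.Adj v w₂ → G.Adj v w₃ → w₁ = w₂ ∨ w₁ = w₃ ∨ w₂ = w₃) :
    ∃ e : V → ℕ, Function.Injective e ∧ (∀ v, e v < Fintype.card V) ∧
      ∀ u v, G.Adj u v → e u ≤ e v + 2 := by
  classical
  -- Greedy numbering: only the last two numbered vertices may have unnumbered neighbors, the
  -- earlier of them at most one; if it has one, the last vertex also has at most one.
  have main : ∀ n ≤ Fintype.card V, ∃ (S : Finset V) (e : V → ℕ), #S = n ∧
      (∀ u ∈ S, ∀ v ∈ S, e u = e v → u = v) ∧ (∀ v ∈ S, e v < n) ∧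
      (∀ u ∈ S, ∀ v ∈ S, G.Adj u v → e u ≤ e v + 2) ∧
      (∀ v ∈ S, e v + 2 < n → ∀ w ∉ S, ¬ G.Adj v w) ∧
      (∀ v ∈ S, e v + 2 = n → ∀ w ∉ S, ∀ w' ∉ S, G.Adj v w → G.Adj v w' → w = w') ∧
      (∀ u ∈ S, e u + 2 = n → ∀ v ∈ S, e v + 1 = n → ∀ w ∉ S, ∀ w' ∉ S, ∀ w'' ∉ S,
        G.Adj u w'' → G.Adj v w → G.Adj v w' → w = w') := by
    intro n
    induction n with
    | zero => exact fun _ => ⟨∅, fun _ => 0, by simp⟩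
    | succ n ih =>
      intro hn
      obtain ⟨S, e, hcard, hinj, hlt, hband, hold, hsnd, hfst⟩ := ih (by omega)
      -- Next comes an unnumbered neighbor of vertex `n - 2`, failing that of vertex `n - 1`,
      -- failing that any unnumbered vertex.
      have hnew : ∃ w ∉ S, ∀ v ∈ S, ∀ w' ∉ S, G.Adj v w' →
          (e v + 2 = n ∧ G.Adj v w) ∨ (e v + 1 = n ∧
            ((∃ u ∈ S, G.Adj u w) ∧ (G.Adj v w ∨ ∃ u ∈ S, e u + 2 = n ∧ G.Adj u w))) := by
        by_cases hp : ∃ p ∈ S, e p + 2 = n ∧ ∃ w ∉ S, G.Adj p w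
        · obtain ⟨p, hpS, hpn, w, hw, hpw⟩ := hp
          refine ⟨w, hw, fun v hv w' hw' hvw' => ?_⟩
          have h1 := hlt v hv
          have h2 := hold v hv
          have h3 : e v + 2 = n → v = p := fun h => hinj v hv p hpS (by omega)
          by_cases h : e v + 2 < n
          · exact absurd hvw' (h2 h w' hw')
          · by_cases h4 : e v + 2 = n
            · exact Or.inl ⟨h4, h3 h4 ▸ hpw⟩
            · exact Or.inr ⟨by omega, ⟨p, hpS, hpw⟩, Or.inr ⟨p, hpS, hpn, hpw⟩⟩
        · by_cases hq : ∃ q ∈ S, e q + 1 = n ∧ ∃ w ∉ S, G.Adj q w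
          · obtain ⟨q, hqS, hqn, w, hw, hqw⟩ := hq
            refine ⟨w, hw, fun v hv w' hw' hvw' => ?_⟩
            have h1 := hlt v hv
            have h2 := hold v hv
            have h3 : e v + 1 = n → v = q := fun h => hinj v hv q hqS (by omega)
            by_cases h : e v + 2 < n
            · exact absurd hvw' (h2 h w' hw')
            · by_cases h4 : e v + 2 = n
              · exact absurd ⟨v, hv, h4, w', hw', hvw'⟩ hp
              · have h5 : e v + 1 = n := by omega
                exact Or.inr ⟨h5, ⟨q, hqS, hqw⟩, Or.inl (h3 h5 ▸ hqw)⟩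
          · obtain ⟨w, hw⟩ : ∃ w, w ∉ S := by
              by_contra! h
              have : S = univ := eq_univ_iff_forall.2 h
              rw [this, card_univ] at hcard
              omega
            refine ⟨w, hw, fun v hv w' hw' hvw' => ?_⟩
            have h1 := hlt v hv
            by_cases h : e v + 2 < n
            · exact absurd hvw' (hold v hv h w' hw')
            · by_cases h4 : e v + 2 = n
              · exact absurd ⟨v, hv, h4, w', hw', hvw'⟩ hp
              · exact absurd ⟨v, hv, by omega, w', hw', hvw'⟩ hq
      obtain ⟨w, hw, hprop⟩ := hnew
      have hew : ∀ v ∈ S, Function.update e w n v = e v := fun v hv =>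
        Function.update_of_ne (ne_of_mem_of_not_mem hv hw) _ _
      have heww : Function.update e w n w = n := Function.update_self _ _ _
      have hvw : ∀ v ∈ S, G.Adj v w → n ≤ e v + 2 := fun v hv h => by
        rcases hprop v hv w hw h with h | h <;> omega
      refine ⟨insert w S, Function.update e w n, by rw [card_insert_of_notMem hw, hcard],
        ?_, ?_, ?_, ?_, ?_, ?_⟩
      · intro u hu' v hv' h
        rcases mem_insert.1 hu' with rfl | hu <;> rcases mem_insert.1 hv' with rfl | hv
        · rfl
        · rw [heww, hew v hv] at h
          have := hlt v hv
          omega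
        · rw [heww, hew u hu] at h
          have := hlt u hu
          omega
        · rw [hew u hu, hew v hv] at h
          exact hinj u hu v hv h
      · intro v hv'
        rcases mem_insert.1 hv' with rfl | hv
        · omega
        · have := hlt v hv
          rw [hew v hv]
          omega
      · intro u hu' v hv' h
        rcases mem_insert.1 hu' with rfl | hu <;> rcases mem_insert.1 hv' with rfl | hv
        · omega
        · rw [heww, hew v hv]
          exact hvw v hv h.symm
        · rw [heww, hew u hu]
          have := hlt u hu
          omega
        · rw [hew u hu, hew v hv]
          exact hband u hu v hv h
      · intro v hv' hvn w' hw' hvw'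
        rw [mem_insert, not_or] at hw'
        rcases mem_insert.1 hv' with rfl | hv
        · omega
        rw [hew v hv] at hvn
        by_cases hvn' : e v + 2 < n
        · exact hold v hv hvn' w' hw'.2 hvw'
        · rcases hprop v hv w' hw'.2 hvw' with h | h
          · exact hw'.1 (hsnd v hv h.1 w' hw'.2 w hw hvw' h.2)
          · omega
      · intro v hv' hvn w₁ hw₁ w₂ hw₂ hv₁ hv₂
        rw [mem_insert, not_or] at hw₁ hw₂
        rcases mem_insert.1 hv' with rfl | hv
        · omega
        rw [hew v hv] at hvn
        rcases hprop v hv w₁ hw₁.2 hv₁ with h | ⟨h, -, h' | ⟨u, hu, hun, huw⟩⟩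
        · omega
        · rcases hG v w w₁ w₂ h' hv₁ hv₂ with h | h | h
          · exact absurd h.symm hw₁.1
          · exact absurd h.symm hw₂.1
          · exact h
        · exact hfst u hu hun v hv h w₁ hw₁.2 w₂ hw₂.2 w hw huw hv₁ hv₂
      · intro u hu' hun v hv' hvn w₁ hw₁ w₂ hw₂ w₃ hw₃ hu₃ hv₁ hv₂
        rw [mem_insert, not_or] at hw₁ hw₂ hw₃
        rcases mem_insert.1 hu' with rfl | hu
        · omega
        rcases mem_insert.1 hv' with rfl | hv
        · rw [hew u hu] at hun
          rcases hprop u hu w₃ hw₃.2 hu₃ with h | ⟨-, ⟨x, hx, hxv⟩, -⟩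
          · omega
          · rcases hG v x w₁ w₂ hxv.symm hv₁ hv₂ with h | h | h
            · exact absurd (h ▸ hx) hw₁.2
            · exact absurd (h ▸ hx) hw₂.2
            · exact h
        · rw [hew v hv] at hvn
          have := hlt v hv
          omega
  obtain ⟨S, e, hcard, hinj, hlt, hband, -⟩ := main _ le_rfl
  have hS : S = univ := (card_eq_iff_eq_univ S).1 hcard
  subst hS
  exact ⟨e, fun u v h => hinj u (mem_univ _) v (mem_univ _) h, fun v => hlt v (mem_univ _),
    fun u v => hband u (mem_univ _) v (mem_univ _)⟩

/-! ### Monochromatic squares of paths -/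

/-- Every two-coloring of the complete graph on `6 * L` vertices contains a monochromatic copy of
the square of a path on `n` vertices, whose vertices in each residue class modulo three are
increasing, with the three residue classes placed one after another. -/
lemma exists_monochromatic_path_square (n L : ℕ) (hL : 432 * n < L)
    (c : SimpleGraph.TopEdgeLabeling (Fin (6 * L)) Bool) :
    ∃ (k : Bool) (F : ℕ → Fin (6 * L)),
      (∀ i j, i < j → j < n → j ≤ i + 2 → (c.labelGraph k).Adj (F i) (F j)) ∧
      (∀ i j, i < n → j < n → (i % 3 < j % 3 ∨ i % 3 = j % 3 ∧ i < j) → F i < F j) := by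
  have hvlt : ∀ (a : Fin 6) (y : Fin L), a.1 * L + y.1 < 6 * L := fun a y =>
    calc a.1 * L + y.1 < (a.1 + 1) * L := by rw [add_mul]; omega
      _ ≤ 6 * L := Nat.mul_le_mul_right _ a.2
  let vtx : Fin 6 → Fin L → Fin (6 * L) := fun a y => ⟨a.1 * L + y.1, hvlt a y⟩
  have hvtx : ∀ a b y z, a < b → vtx a y < vtx b z := fun a b y z hab => by
    change a.1 * L + y.1 < b.1 * L + z.1
    calc a.1 * L + y.1 < (a.1 + 1) * L := by rw [add_mul]; omega
      _ ≤ b.1 * L := Nat.mul_le_mul_right _ hab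
      _ ≤ _ := Nat.le_add_right _ _
  have hmono : ∀ u : Fin 6 → Fin L, ∃ o : (Fin 3 → Fin 6) × Bool, StrictMono o.1 ∧
      ∀ i j, i < j →
        (c.labelGraph o.2).Adj (vtx (o.1 i) (u (o.1 i))) (vtx (o.1 j) (u (o.1 j))) := by
    intro u
    obtain ⟨g, k, hg, hk⟩ := exists_monochromatic_triple fun a b =>
      -- The default `true` is never used: vertices in different intervals are distinct.
      if h : vtx a (u a) ≠ vtx b (u b) then c.get _ _ h else true
    refine ⟨(g, k), hg, fun i j hij => ?_⟩
    have hne := (hvtx (g i) (g j) (u (g i)) (u (g j)) (hg hij)).ne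
    have := hk i j hij
    rw [dif_pos hne] at this
    exact (SimpleGraph.TopEdgeLabeling.labelGraph_adj _ _).2 ⟨hne, this⟩
  choose o ho hadj using hmono
  -- There are `6 ^ 3 * 2 = 432` pairs of a map and a color.
  obtain ⟨⟨g, k⟩, hcard⟩ := Fintype.exists_lt_card_fiber_of_mul_lt_card
    (f := o) (n := n * L ^ 5) (by
      simp only [Fintype.card_prod, Fintype.card_fun, Fintype.card_fin,
        Fintype.card_bool]
      calc 6 ^ 3 * 2 * (n * L ^ 5) = (432 * n) * L ^ 5 := by ring
        _ < L * L ^ 5 := Nat.mul_lt_mul_of_pos_right hL (pow_pos (by omega) 5)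
        _ = L ^ 6 := by ring)
  let p : ℕ → Fin 3 := fun i => ⟨i % 3, Nat.mod_lt _ (by norm_num)⟩
  obtain ⟨x, hx, hstep⟩ := exists_increasing_walk (fun j => g (p j)) n _
    (by simpa only [Fintype.card_fin] using hcard)
  have hox : ∀ i ≤ n, o (x i) = (g, k) := fun i hi => (mem_filter.1 (hx i hi)).2
  have hg : StrictMono g := by
    have := ho (x 0)
    rwa [hox 0 (Nat.zero_le _)] at this
  have hadj' : ∀ m ≤ n, ∀ i j, i ≠ j →
      (c.labelGraph k).Adj (vtx (g i) (x m (g i))) (vtx (g j) (x m (g j))) := by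
    intro m hm i j hij
    have := hadj (x m)
    rw [hox m hm] at this
    rcases lt_or_gt_of_ne hij with h | h
    · exact this i j h
    · exact (this j i h).symm
  have hle : ∀ a i j, i ≤ j → j ≤ n → x i a ≤ x j a := by
    intro a i j hij
    induction j, hij using Nat.le_induction with
    | base => exact fun _ => le_rfl
    | succ j hij ih =>
      intro hj
      refine (ih (by omega)).trans ?_
      by_cases ha : a = g (p j)
      · exact ha ▸ (hstep j hj).1.le
      · exact ((hstep j hj).2 a ha).ge
  refine ⟨k, fun i => vtx (g (p i)) (x i (g (p i))), fun i j hij hj hji => ?_,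
    fun i j hi hj hij => ?_⟩
  -- Steps `i, …, j - 1` leave coordinate `g (p j)` fixed, so `F i` and `F j` both lie in the
  -- triangle at `x i`.
  · have hp : ∀ m, i ≤ m → m < j → p j ≠ p m := fun m h1 h2 h => by
      have : j % 3 = m % 3 := congrArg Fin.val h
      omega
    have hconst : x j (g (p j)) = x i (g (p j)) := by
      have h1 := (hstep i (by omega)).2 _ (hg.injective.ne (hp i le_rfl hij))
      obtain rfl | rfl : j = i + 1 ∨ j = i + 2 := by omega
      · exact h1
      · exact ((hstep (i + 1) (by omega)).2 _
          (hg.injective.ne (hp (i + 1) (by omega) (by omega)))).trans h1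
    dsimp only
    rw [hconst]
    exact hadj' i (by omega) _ _ (hp i le_rfl hij).symm
  · rcases hij with h | ⟨h, hlt⟩
    · exact hvtx _ _ _ _ (hg h)
    · have hp : p i = p j := Fin.ext h
      have h1 : x i (g (p j)) < x j (g (p j)) :=
        hp ▸ ((hstep i hi).1.trans_le (hle _ (i + 1) j hlt hj.le))
      dsimp only
      rw [hp]
      change (g (p j)).1 * L + _ < (g (p j)).1 * L + _
      exact Nat.add_lt_add_left h1 _

/-- A graph on `n` vertices with bandwidth at most two has an ordering with ordered Ramsey number
linear in `n`. -/
lemma minOrderedRamseyNumber_le_of_bandwidth {V : Type*} (G : SimpleGraph V) (n : ℕ) (hn : 0 < n)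
    (e : V → ℕ) (he : Function.Injective e) (hlt : ∀ v, e v < n)
    (hband : ∀ u v, G.Adj u v → e u ≤ e v + 2) :
    minOrderedRamseyNumber G ≤ ((2598 * n : ℕ) : ℕ∞) := by
  let key : V → ℕ := fun v => (e v % 3) * n + e v / 3
  have hdiv : ∀ v, e v / 3 < n := fun v => (Nat.div_le_self _ _).trans_lt (hlt v)
  have hkey : ∀ u v, key u ≤ key v → e u % 3 < e v % 3 ∨ e u % 3 = e v % 3 ∧ e u ≤ e v := by
    intro u v h
    change e u % 3 * n + e u / 3 ≤ e v % 3 * n + e v / 3 at h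
    rcases lt_trichotomy (e u % 3) (e v % 3) with h1 | h1 | h1
    · exact Or.inl h1
    · rw [h1] at h
      exact Or.inr ⟨h1, by omega⟩
    · have h2 : (e v % 3 + 1) * n ≤ e u % 3 * n := Nat.mul_le_mul_right _ h1
      have h3 := hdiv v
      rw [add_mul] at h2
      omega
  have hinj : Function.Injective key := fun u v h => he <| by
    have h1 := hkey u v h.le
    have h2 := hkey v u h.ge
    omega
  refine (iInf_le _ (LinearOrder.lift' key hinj)).trans ?_
  let _ : LinearOrder V := LinearOrder.lift' key hinj
  -- `L = 433 * n` meets the strict bound `432 * n < L` because `n` is positive.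
  refine (iInf₂_le (6 * (433 * n)) fun c => ?_).trans (le_of_eq (by rw [← mul_assoc, show 6 * 433 = 2598 from rfl]))
  obtain ⟨k, F, hF, hFlt⟩ := exists_monochromatic_path_square n (433 * n) (by omega) c
  refine ⟨k, OrderEmbedding.ofStrictMono (fun v => F (e v)) fun u v huv => ?_, fun u v huv => ?_⟩
  · have h : key u < key v := huv
    refine hFlt _ _ (hlt u) (hlt v) ((hkey u v h.le).imp_right fun h1 => ⟨h1.1, ?_⟩)
    exact h1.2.lt_of_ne fun h2 => h.ne (congrArg key (he h2))
  · change (c.labelGraph k).Adj (F (e u)) (F (e v))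
    rcases lt_or_gt_of_ne (he.ne huv.ne) with h | h
    · exact hF _ _ h (hlt v) (hband v u huv.symm)
    · exact (hF _ _ h (hlt u) (hband u v huv)).symm

end OrderedRamsey

theorem mainTheorem3 :
    ∃ C : ℕ, ∀ (V : Type*) [Fintype V] (G : SimpleGraph V) [DecidableRel G.Adj],
      G.maxDegree ≤ 2 →
        OrderedRamsey.minOrderedRamseyNumber G ≤ ((C * Fintype.card V : ℕ) : ℕ∞) := by
  classical
  refine ⟨2598, fun V _ G _ hG => ?_⟩
  rcases isEmpty_or_nonempty V with hV | hV
  · let ord : LinearOrder V :=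
      LinearOrder.lift' (fun _ => 0 : V → ℕ) (Function.injective_of_subsingleton _)
    refine (iInf_le _ ord).trans ((iInf₂_le 0 fun c => ⟨true, ?_⟩).trans zero_le)
    exact ⟨OrderEmbedding.ofIsEmpty, fun v => isEmptyElim v⟩
  · obtain ⟨e, he, hlt, hband⟩ := OrderedRamsey.exists_bandwidth_le_two G <| by
      intro v w₁ w₂ w₃ h₁ h₂ h₃
      by_contra! hne
      have hsub : ({w₁, w₂, w₃} : Finset V) ⊆ G.neighborFinset v := by
        intro w hw
        simp only [Finset.mem_insert, Finset.mem_singleton] at hw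
        rw [SimpleGraph.mem_neighborFinset]
        rcases hw with rfl | rfl | rfl <;> assumption
      have h := Finset.card_le_card hsub
      rw [Finset.card_eq_three.2 ⟨w₁, w₂, w₃, hne.1, hne.2.1, hne.2.2, rfl⟩,
        SimpleGraph.card_neighborFinset_eq_degree] at h
      have := G.degree_le_maxDegree v
      omega
    exact OrderedRamsey.minOrderedRamseyNumber_le_of_bandwidth G _ Fintype.card_pos e he hlt hband
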